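/- For a graph $(V,E)$, a set $X\subseteq V$ and $b\in V$, write $E(X,b)$ for the set of $a\in X$ adjacent to $b$. A graph $(V,E)$ is $k$-stable if there do not exist $v_1,\dots,v_k,w_1,\dots,w_k\in V$ such that, for all $i,j$, $E(v_i,w_j)$ holds if and only if $i\le j$. For a finite graph $(V,E)$ and $\gamma>0$, a set $X\subseteq V$ is $\gamma$-good in $(V,E)$ if for every $b\in V$ either $|E(X,b)|<\gamma|X|$ or $|E(X,b)|>(1-\gamma)|X|$. Fix $k\geq 1$, $\epsilon>0$, and $\sigma\colon\mathbb N\to(0,1)$. Then there is a constant $N$, depending only on $k$, $\epsilon$ and $\sigma$, such that for every finite $k$-stable simple graph $(V,E)$ with $V\neq\emptyset$ there are $1\le m\leq N$ and a partition $V=X_0\cup X_1\cup\dots\cup X_m$ into pairwise disjoint sets ($X_0$ may be empty) such that $|X_0|<\epsilon|V|$ and, for all $1\le i\le m$, $X_i$ is $\sigma(m)$-good in $(V,E)$. -/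

import Mathlib

/-- A graph is `k`-stable if there are no vertices `v₁, …, v_k, w₁, …, w_k` (repetitions allowed)
such that `v_i` is adjacent to `w_j` if and only if `i ≤ j`. -/
def IsKStable {V : Type*} (G : SimpleGraph V) (k : ℕ) : Prop :=
  ¬ ∃ v w : Fin k → V, ∀ i j : Fin k, G.Adj (v i) (w j) ↔ i ≤ j

/-- `edgeNbhd G X b` is `E(X, b)`, the set of `a ∈ X` that are adjacent to `b`. -/
def edgeNbhd {V : Type*} (G : SimpleGraph V) (X : Set V) (b : V) : Set V :=
  {a ∈ X | G.Adj a b}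

/-- A set `X` of vertices of a finite graph is `ε`-good if, for every vertex `b` of the graph,
either `|E(X, b)| < ε |X|` or `|E(X, b)| > (1 - ε) |X|`. -/
def IsGood {V : Type*} (G : SimpleGraph V) (ε : ℝ) (X : Set V) : Prop :=
  ∀ b : V, ((edgeNbhd G X b).ncard : ℝ) < ε * (X.ncard : ℝ) ∨
    (1 - ε) * (X.ncard : ℝ) < ((edgeNbhd G X b).ncard : ℝ)

/-- The family `X` partitions `V`: the sets are pairwise disjoint and cover `V`
(members are allowed to be empty). -/
def IsPartitionOf {ι V : Type*} (X : ι → Set V) : Prop :=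
  (∀ i j : ι, i ≠ j → Disjoint (X i) (X j)) ∧ (⋃ i, X i) = Set.univ

/-! The height of splitting trees acts as a rank, which `k`-stability bounds: a tall tree yields a
half-graph (`HasSplitTree.exists_halfGraph`). `exists_good_subfamily` is an induction on this rank.
From each set of rank at most `r`, largest subsets of smaller rank are removed greedily. After many
steps the remaining core contains no sizeable subset of smaller rank. Since a vertex cannot split it
into two parts of full rank, one part is small; so a large core is good.

The difficulty is that goodness must depend on the final number of pieces: the number `T` of steps
depends on how many pieces the induction makes of the removed sets. So only the first `s` removed
sets are passed to the induction, `T` is chosen from the resulting bound, and sets `s` to `T - 1`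
are discarded. Pigeonhole over disjoint blocks `[s, T)` makes this loss small. -/

/-! ### Splitting trees and half-graphs. -/

/-- `HasSplitTree G B n X`: the set `X` can be split along a full binary tree of height `n`, where
each splitting is into neighbours and non-neighbours of a vertex of `B`, and all the leaves are
nonempty. -/
def HasSplitTree {V : Type*} (G : SimpleGraph V) (B : Set V) : ℕ → Set V → Prop
  | 0, X => X.Nonempty
  | n + 1, X => ∃ b ∈ B, HasSplitTree G B n (edgeNbhd G X b) ∧
      HasSplitTree G B n (X \ edgeNbhd G X b)

theorem edgeNbhd_subset {V : Type*} (G : SimpleGraph V) (X : Set V) (b : V) :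
    edgeNbhd G X b ⊆ X := fun _ h => h.1

theorem HasSplitTree.mono {V : Type*} {G : SimpleGraph V} {B : Set V} {n : ℕ} {X Y : Set V}
    (h : HasSplitTree G B n X) (hXY : X ⊆ Y) : HasSplitTree G B n Y := by
  induction n generalizing X Y with
  | zero => exact Set.Nonempty.mono hXY h
  | succ n ih =>
    obtain ⟨b, hb, h1, h2⟩ := h
    exact ⟨b, hb, ih h1 fun a ha => ⟨hXY ha.1, ha.2⟩,
      ih h2 fun a ha => ⟨hXY ha.1, fun h => ha.2 ⟨ha.1, h.2⟩⟩⟩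

theorem HasSplitTree.nonempty {V : Type*} {G : SimpleGraph V} {B : Set V} {n : ℕ} {X : Set V}
    (h : HasSplitTree G B n X) : X.Nonempty := by
  induction n generalizing X with
  | zero => exact h
  | succ n ih =>
    obtain ⟨b, -, h1, -⟩ := h
    exact (ih h1).mono (edgeNbhd_subset G X b)

/-- Ramsey property of splitting trees. -/
theorem HasSplitTree.of_union {V : Type*} {G : SimpleGraph V} {B B₁ B₂ : Set V}
    (hB : B ⊆ B₁ ∪ B₂) (n m : ℕ) {X : Set V} (h : HasSplitTree G B (n + m) X) :
    HasSplitTree G B₁ n X ∨ HasSplitTree G B₂ m X := by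
  induction hs : n + m generalizing n m X with
  | zero =>
    obtain rfl : n = 0 := by omega
    exact Or.inl h.nonempty
  | succ s ih =>
    rcases n with _ | n
    · exact Or.inl h.nonempty
    rcases m with _ | m
    · exact Or.inr h.nonempty
    rw [hs] at h
    obtain ⟨b, hb, h1, h2⟩ := h
    rcases hB hb with hb | hb
    -- A `B₂`-tree in either child suffices; otherwise both children carry `B₁`-trees, which the
    -- root label joins.
    · have e : n + (m + 1) = s := by omega
      rcases ih n (m + 1) (e ▸ h1) e with h1 | h1
      · rcases ih n (m + 1) (e ▸ h2) e with h2 | h2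
        · exact Or.inl ⟨b, hb, h1, h2⟩
        · exact Or.inr (h2.mono Set.sdiff_subset)
      · exact Or.inr (h1.mono (edgeNbhd_subset G X b))
    · have e : (n + 1) + m = s := by omega
      rcases ih (n + 1) m (e ▸ h1) e with h1 | h1
      · exact Or.inl (h1.mono (edgeNbhd_subset G X b))
      · rcases ih (n + 1) m (e ▸ h2) e with h2 | h2
        · exact Or.inl (h2.mono Set.sdiff_subset)
        · exact Or.inr ⟨b, hb, h1, h2⟩

/-- A tall splitting tree contains an edge `a b` and a splitting tree of half the height all of
whose leaves and labels lie on the same side of that edge in the half-graph order. -/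
theorem HasSplitTree.exists_edge {V : Type*} {G : SimpleGraph V} {B : Set V} {n : ℕ} {X : Set V}
    (h : HasSplitTree G B (n + (n + 1) + 1) X) :
    ∃ a ∈ X, ∃ b ∈ B, G.Adj a b ∧ ∃ X' ⊆ X, ∃ B' ⊆ B, HasSplitTree G B' n X' ∧
      (((∀ x ∈ X', G.Adj x b) ∧ ∀ y ∈ B', ¬ G.Adj a y) ∨
        ((∀ x ∈ X', ¬ G.Adj x b) ∧ ∀ y ∈ B', G.Adj a y)) := by
  obtain ⟨b, hb, h1, -⟩ := h
  obtain ⟨a, ha⟩ := h1.nonempty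
  have hB : B ⊆ {y ∈ B | ¬ G.Adj a y} ∪ {y ∈ B | G.Adj a y} := fun y hy => by
    by_cases hy' : G.Adj a y
    · exact Or.inr ⟨hy, hy'⟩
    · exact Or.inl ⟨hy, hy'⟩
  -- The second alternative gets one extra level: its root `c` supplies the edge `a c`, and its
  -- non-neighbour side the smaller tree.
  rcases h1.of_union hB with h2 | ⟨c, hc, -, h2⟩
  · exact ⟨a, ha.1, b, hb, ha.2, _, edgeNbhd_subset G X b, _, fun y hy => hy.1, h2,
      Or.inl ⟨fun x hx => hx.2, fun y hy => hy.2⟩⟩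
  · exact ⟨a, ha.1, c, hc.1, hc.2, _, fun x hx => hx.1.1, _, fun y hy => hy.1, h2,
      Or.inr ⟨fun x hx hxc => hx.2 ⟨hx.1, hxc⟩, fun y hy => hy.2⟩⟩

/-- Each new pair costs one use of `exists_edge`, so the heights satisfy `h (k + 1) = 2 * h k + 2`
with `h 0 = 0`. -/
theorem HasSplitTree.exists_halfGraph {V : Type*} {G : SimpleGraph V} (k : ℕ) {B X : Set V}
    (h : HasSplitTree G B (2 * (2 ^ k - 1)) X) :
    ∃ v w : Fin k → V, (∀ i, v i ∈ X) ∧ (∀ i, w i ∈ B) ∧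
      ∀ i j : Fin k, G.Adj (v i) (w j) ↔ i ≤ j := by
  induction k generalizing B X with
  | zero => exact ⟨Fin.elim0, Fin.elim0, fun i => i.elim0, fun i => i.elim0, fun i => i.elim0⟩
  | succ k ih =>
    have e : 2 * (2 ^ (k + 1) - 1) = 2 * (2 ^ k - 1) + (2 * (2 ^ k - 1) + 1) + 1 := by
      have := Nat.one_le_two_pow (n := k)
      rw [pow_succ]
      omega
    rw [e] at h
    obtain ⟨a, ha, b, hb, hab, X', hX', B', hB', hT, hcase⟩ := h.exists_edge
    obtain ⟨v, w, hv, hw, hvw⟩ := ih hT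
    rcases hcase with ⟨h1, h2⟩ | ⟨h1, h2⟩
    -- The new pair goes last here, and first in the other case.
    · refine ⟨Fin.snoc (α := fun _ => V) v a, Fin.snoc (α := fun _ => V) w b, ?_, ?_, ?_⟩
      · refine Fin.lastCases ?_ fun i => ?_
        · simpa using ha
        · simpa using hX' (hv i)
      · refine Fin.lastCases ?_ fun i => ?_
        · simpa using hb
        · simpa using hB' (hw i)
      · refine Fin.lastCases ?_ fun i => ?_
        · refine Fin.lastCases ?_ fun j => ?_
          · simpa using hab
          · simpa using h2 _ (hw j)
        · refine Fin.lastCases ?_ fun j => ?_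
          · simpa [Fin.le_last] using h1 _ (hv i)
          · simpa using hvw i j
    · refine ⟨Fin.cons (α := fun _ => V) a v, Fin.cons (α := fun _ => V) b w, ?_, ?_, ?_⟩
      · refine Fin.cases ?_ fun i => ?_
        · simpa using ha
        · simpa using hX' (hv i)
      · refine Fin.cases ?_ fun i => ?_
        · simpa using hb
        · simpa using hB' (hw i)
      · refine Fin.cases ?_ fun i => ?_
        · refine Fin.cases ?_ fun j => ?_
          · simpa using hab
          · simpa using h2 _ (hw j)
        · refine Fin.cases ?_ fun j => ?_
          · simpa using h1 _ (hv i)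
          · simpa using hvw i j

theorem IsKStable.not_hasSplitTree {V : Type*} {G : SimpleGraph V} {k : ℕ} (h : IsKStable G k)
    (B X : Set V) : ¬ HasSplitTree G B (2 * (2 ^ k - 1)) X := fun hT => by
  obtain ⟨v, w, -, -, hvw⟩ := hT.exists_halfGraph k
  exact h ⟨v, w, hvw⟩

/-! ### Greedy removal and a criterion for goodness. -/

theorem IsGood.mono {V : Type*} [Finite V] {G : SimpleGraph V} {γ δ : ℝ} {X : Set V}
    (h : IsGood G γ X) (hγ : γ ≤ δ) : IsGood G δ X := fun b => by
  have h0 : γ * (X.ncard : ℝ) ≤ δ * X.ncard := by gcongr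
  rcases h b with h | h
  · exact Or.inl (by linarith)
  · exact Or.inr (by linarith)

theorem Set.ncard_biUnion_finset {ι V : Type*} [Finite V] (t : Finset ι) (f : ι → Set V)
    (h : (t : Set ι).PairwiseDisjoint f) : (⋃ i ∈ t, f i).ncard = ∑ i ∈ t, (f i).ncard := by
  rw [← finsum_mem_coe_finset]
  exact t.finite_toSet.ncard_biUnion (fun _ _ => Set.toFinite _) h

/-- Greedily removing largest subsets without a splitting tree of height `r` from `X`. -/
theorem exists_greedy_sequence {V : Type*} [Finite V] (G : SimpleGraph V) (r : ℕ) (X : Set V) :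
    ∃ L : ℕ → Set V, (∀ t, L t ⊆ X) ∧ Pairwise (Function.onFun Disjoint L) ∧
      (∀ t, ¬ HasSplitTree G Set.univ r (L t)) ∧
      ∀ T, ∀ M ⊆ X \ ⋃ t < T, L t, ¬ HasSplitTree G Set.univ r M →
        T * M.ncard ≤ X.ncard := by
  have hmax : ∀ C : Set V, ∃ L ⊆ C, ¬ HasSplitTree G Set.univ r L ∧
      ∀ M ⊆ C, ¬ HasSplitTree G Set.univ r M → M.ncard ≤ L.ncard := fun C => by
    obtain ⟨L, hL, hLmax⟩ := Set.exists_max_image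
      {L : Set V | L ⊆ C ∧ ¬ HasSplitTree G Set.univ r L} Set.ncard (Set.toFinite _)
      ⟨∅, Set.empty_subset _, fun h => Set.not_nonempty_empty h.nonempty⟩
    exact ⟨L, hL.1, hL.2, fun M h1 h2 => hLmax M ⟨h1, h2⟩⟩
  choose f hfC hfr hfmax using hmax
  let C : ℕ → Set V := fun t => Nat.rec X (fun _ D => D \ f D) t
  have hCs : ∀ t, C (t + 1) = C t \ f (C t) := fun t => rfl
  have hC : ∀ t, C t = X \ ⋃ s < t, f (C s) := fun t => by
    induction t with
    | zero => simp [C]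
    | succ t ih =>
      rw [hCs, Set.biUnion_lt_succ, ← Set.sdiff_sdiff, ← ih]
  have hdisj : Pairwise (Function.onFun Disjoint fun t => f (C t)) := by
    rw [pairwise_disjoint_on]
    intro s t hst
    refine Set.disjoint_left.2 fun a h1 h2 => ?_
    have := hfC _ h2
    rw [hC t] at this
    exact this.2 (Set.mem_biUnion hst h1)
  have hsub : ∀ t, f (C t) ⊆ X := fun t => (hfC _).trans (by rw [hC t]; exact Set.sdiff_subset)
  refine ⟨fun t => f (C t), hsub, hdisj, fun t => hfr _, fun T M hM hMr => ?_⟩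
  have h1 : ∀ t ∈ Finset.range T, M.ncard ≤ (f (C t)).ncard := fun t ht => by
    refine hfmax _ M (hM.trans ?_) hMr
    rw [hC t]
    refine Set.sdiff_subset_sdiff_right (Set.biUnion_subset_biUnion_left fun s hs => ?_)
    exact lt_trans hs (Finset.mem_range.1 ht)
  calc T * M.ncard = ∑ _t ∈ Finset.range T, M.ncard := by simp
    _ ≤ ∑ t ∈ Finset.range T, (f (C t)).ncard := Finset.sum_le_sum h1
    _ = (⋃ t ∈ Finset.range T, f (C t)).ncard :=
      (Set.ncard_biUnion_finset _ _ fun s _ t _ h => hdisj h).symm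
    _ ≤ X.ncard := Set.ncard_le_ncard (Set.iUnion₂_subset fun t _ => hsub t)

/-- If every subset of `C` without a splitting tree of height `r` is small, while `C` has no
splitting tree of height `r + 1`, then `C` is good. -/
theorem isGood_of_forall_subset_lt {V : Type*} [Finite V] {G : SimpleGraph V} {r : ℕ} {C : Set V}
    {γ : ℝ} (hC : ¬ HasSplitTree G Set.univ (r + 1) C)
    (h : ∀ M ⊆ C, ¬ HasSplitTree G Set.univ r M → (M.ncard : ℝ) < γ * C.ncard) :
    IsGood G γ C := fun b => by
  by_cases hb : HasSplitTree G Set.univ r (edgeNbhd G C b)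
  · right
    have h1 := h (C \ edgeNbhd G C b) Set.sdiff_subset fun h2 => hC ⟨b, trivial, hb, h2⟩
    have h2 := Set.ncard_sdiff_add_ncard_of_subset (edgeNbhd_subset G C b) (Set.toFinite C)
    have h3 : ((C \ edgeNbhd G C b).ncard : ℝ) + (edgeNbhd G C b).ncard = C.ncard := by
      exact_mod_cast h2
    linarith
  · exact Or.inl (h _ (edgeNbhd_subset G C b) hb)

/-- Among sufficiently many pairwise disjoint sets, one has small density. -/
theorem exists_ncard_le_of_pairwise_disjoint {V : Type*} [Finite V] [Nonempty V] {K : ℕ}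
    {δ : ℝ} (hK : 1 < K * δ) (D : ℕ → Set V) (hD : Pairwise (Function.onFun Disjoint D)) :
    ∃ i < K, ((D i).ncard : ℝ) ≤ δ * Nat.card V := by
  by_contra! hcon
  have hV : (0 : ℝ) < Nat.card V := by exact_mod_cast Nat.card_pos
  have h1 : (K : ℝ) * (δ * Nat.card V) ≤ ∑ i ∈ Finset.range K, ((D i).ncard : ℝ) := by
    calc (K : ℝ) * (δ * Nat.card V) = ∑ _i ∈ Finset.range K, δ * (Nat.card V : ℝ) := by simp
      _ ≤ _ := Finset.sum_le_sum fun i hi => (hcon i (Finset.mem_range.1 hi)).le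
  have h2 : ∑ i ∈ Finset.range K, (D i).ncard ≤ Nat.card V := by
    rw [← Set.ncard_biUnion_finset _ _ fun s _ t _ h => hD h]
    exact Set.ncard_le_card _
  have h3 : ∑ i ∈ Finset.range K, ((D i).ncard : ℝ) ≤ Nat.card V := by exact_mod_cast h2
  nlinarith

/-! ### The induction on rank. -/

theorem exists_pos_forall_le {σ : ℕ → ℝ} (hσ : ∀ n, 0 < σ n) (M : ℕ) :
    ∃ τ : ℝ, 0 < τ ∧ ∀ m ≤ M, τ ≤ σ m := by
  obtain ⟨j, -, hj⟩ := Finset.exists_min_image (Finset.range (M + 1)) σ ⟨0, by simp⟩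
  exact ⟨σ j, hσ j, fun m hm => hj m (Finset.mem_range.2 (by omega))⟩

universe u in
/-- A bounded family of disjoint sets without splitting trees of height `r` can be refined, up to a
set of density `ε`, to a bounded family of disjoint sets whose goodness depends on their number. -/
theorem exists_good_subfamily (r : ℕ) : ∀ (ε : ℝ) (_ : 0 < ε) (σ : ℕ → ℝ) (_ : ∀ n, 0 < σ n)
    (n : ℕ), ∃ N : ℕ, ∀ (V : Type u) [Finite V] [Nonempty V] (G : SimpleGraph V)
      (A : Finset (Set V)), A.card ≤ n → (A : Set (Set V)).PairwiseDisjoint id →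
      (∀ Y ∈ A, ¬ HasSplitTree G Set.univ r Y) →
      ∃ B : Finset (Set V), B.card ≤ N ∧ (B : Set (Set V)).PairwiseDisjoint id ∧
        (∀ X ∈ B, IsGood G (σ B.card) X) ∧ (∀ X ∈ B, X ⊆ ⋃₀ (A : Set (Set V))) ∧
        ((⋃₀ (A : Set (Set V)) \ ⋃₀ (B : Set (Set V))).ncard : ℝ) ≤ ε * Nat.card V := by
  classical
  induction r with
  | zero =>
    intro ε hε σ hσ n
    refine ⟨0, fun V _ _ G A _ _ hA => ⟨∅, by simp, by simp, by simp, by simp, ?_⟩⟩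
    have : ⋃₀ (A : Set (Set V)) = ∅ :=
      Set.sUnion_eq_empty.2 fun Y hY => Set.not_nonempty_iff_eq_empty.1 (hA Y hY)
    rw [this]
    simp only [Set.empty_sdiff, Set.ncard_empty, Nat.cast_zero]
    positivity
  | succ r ih =>
    intro ε hε σ hσ n
    choose τ hτ0 hτ using exists_pos_forall_le hσ
    set δ : ℝ := ε / 3 / (n + 1) with hδ
    have hδ0 : 0 < δ := by positivity
    have hnδ : n * δ ≤ ε / 3 := by
      rw [hδ, mul_div_assoc', div_le_iff₀ (by positivity)]
      nlinarith
    -- The shift by `n` leaves room for the at most `n` cores added to the family later.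
    choose N hN using fun s : ℕ =>
      ih (ε / 3) (by positivity) (fun m => τ (m + n)) (fun m => hτ0 _) (n * s)
    -- `T` steps force subsets of smaller rank below the fraction `τ (N s + n)` of any core of
    -- density at least `δ`.
    have hF : ∀ s, ∃ T : ℕ, s ≤ T ∧ 1 < T * τ (N s + n) * δ := fun s => by
      have h0 : 0 < τ (N s + n) * δ := mul_pos (hτ0 _) hδ0
      obtain ⟨T, hT⟩ := exists_nat_gt (1 / (τ (N s + n) * δ))
      rw [div_lt_iff₀ h0] at hT
      refine ⟨s + T, by omega, ?_⟩
      push_cast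
      have : 0 ≤ (s : ℝ) * (τ (N s + n) * δ) := by positivity
      linarith
    choose F hsF hF using hF
    let S : ℕ → ℕ := fun i => Nat.rec 0 (fun _ s => F s) i
    have hS : ∀ i, S (i + 1) = F (S i) := fun i => rfl
    have hSmono : Monotone S := monotone_nat_of_le_succ fun i => hsF _
    obtain ⟨K, hK⟩ := exists_nat_gt (1 / (ε / 3))
    rw [div_lt_iff₀ (by positivity)] at hK
    refine ⟨∑ i ∈ Finset.range K, N (S i) + n, fun V _ _ G A hAn hAd hA => ?_⟩
    choose L hLsub hLdisj hLr hLmax using fun Y : Set V => exists_greedy_sequence G r Y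
    have hL : ∀ Y ∈ A, ∀ Y' ∈ A, ∀ t t', (Y ≠ Y' ∨ t ≠ t') → Disjoint (L Y t) (L Y' t') := by
      intro Y hY Y' hY' t t' h
      by_cases hYY : Y = Y'
      · subst hYY
        exact hLdisj Y (h.resolve_left (by simp))
      · exact (hAd hY hY' hYY).mono (hLsub _ _) (hLsub _ _)
    -- a block of removal steps that removes little
    obtain ⟨i, hiK, hi⟩ := exists_ncard_le_of_pairwise_disjoint hK
      (fun i => ⋃ Y ∈ A, ⋃ t ∈ Set.Ico (S i) (S (i + 1)), L Y t) <| by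
        rw [pairwise_disjoint_on]
        intro i j hij
        simp only [Set.disjoint_iUnion_left, Set.disjoint_iUnion_right]
        intro Y hY t ht Y' hY' t' ht'
        have hij' := hSmono (show i + 1 ≤ j from hij)
        refine hL _ (by assumption) _ (by assumption) _ _ (Or.inr ?_)
        grind
    set s := S i
    rw [hS] at hi
    set T := F s
    have hsT : s ≤ T := hsF s
    let Z : Finset (Set V) := (A ×ˢ Finset.range s).image fun p => L p.1 p.2
    have hZmem : ∀ X, X ∈ Z ↔ ∃ Y ∈ A, ∃ t < s, L Y t = X := fun X => by
      simp [Z, and_assoc]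
    obtain ⟨B, hBN, hBd, hBg, hBZ, hBc⟩ := hN s V G Z
      (by
        refine Finset.card_image_le.trans ?_
        rw [Finset.card_product, Finset.card_range]
        gcongr)
      (by
        intro X hX X' hX' hne
        obtain ⟨Y, hY, t, -, rfl⟩ := (hZmem X).1 hX
        obtain ⟨Y', hY', t', -, rfl⟩ := (hZmem X').1 hX'
        refine hL Y hY Y' hY' t t' ?_
        by_contra! h
        exact hne (by rw [h.1, h.2]))
      (by
        intro X hX
        obtain ⟨Y, hY, t, -, rfl⟩ := (hZmem X).1 hX
        exact hLr Y t)
    let core : Set V → Set V := fun Y => Y \ ⋃ t < T, L Y t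
    -- Cores below density `δ` are discarded, at a total cost of at most `n * δ ≤ ε / 3`.
    let A' := A.filter fun Y => δ * Nat.card V ≤ (core Y).ncard
    let C := A'.image core
    have hCn : C.card ≤ n :=
      Finset.card_image_le.trans ((Finset.card_filter_le _ _).trans hAn)
    have hCmem : ∀ X, X ∈ C ↔ ∃ Y ∈ A, δ * Nat.card V ≤ (core Y).ncard ∧ core Y = X := fun X => by
      simp [C, A', and_assoc]
    have hBC : ∀ X ∈ B, ∀ X' ∈ C, Disjoint X X' := fun X hX X' hX' => by
      obtain ⟨Y, hY, -, rfl⟩ := (hCmem X').1 hX'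
      refine Disjoint.mono_left (hBZ X hX) (Set.disjoint_sUnion_left.2 fun W hW => ?_)
      obtain ⟨Y', hY', t, ht, rfl⟩ := (hZmem W).1 hW
      by_cases hYY : Y' = Y
      · subst hYY
        exact Set.disjoint_left.2 fun a ha ha' =>
          ha'.2 (Set.mem_biUnion (show t ∈ {t | t < T} from lt_of_lt_of_le ht hsT) ha)
      · exact (hAd hY' hY hYY).mono (hLsub _ _) Set.sdiff_subset
    have hcard1 : (B ∪ C).card ≤ B.card + n := (Finset.card_union_le _ _).trans (by omega)
    have hV : (0 : ℝ) < Nat.card V := by exact_mod_cast Nat.card_pos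
    refine ⟨B ∪ C, ?_, ?_, ?_, ?_, ?_⟩
    · have hNs : N s ≤ ∑ i ∈ Finset.range K, N (S i) := Finset.single_le_sum (f := fun i => N (S i)) (fun _ _ => Nat.zero_le _)
        (Finset.mem_range.2 hiK)
      omega
    · rw [Finset.coe_union, Set.pairwiseDisjoint_union]
      refine ⟨hBd, fun X hX X' hX' hne => ?_, fun X hX X' hX' _ => hBC X hX X' hX'⟩
      obtain ⟨Y, hY, -, rfl⟩ := (hCmem X).1 hX
      obtain ⟨Y', hY', -, rfl⟩ := (hCmem X').1 hX'
      exact (hAd hY hY' fun h => hne (by rw [h])).mono Set.sdiff_subset Set.sdiff_subset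
    · intro X hX
      rcases Finset.mem_union.1 hX with hX | hX
      · exact (hBg X hX).mono (hτ _ _ hcard1)
      · obtain ⟨Y, hY, hbig, rfl⟩ := (hCmem X).1 hX
        refine IsGood.mono (γ := τ (N s + n)) ?_ (hτ _ _ (by omega))
        refine isGood_of_forall_subset_lt (r := r)
          (fun h => hA Y hY (h.mono Set.sdiff_subset)) fun M hM hMr => ?_
        have h1 : (T : ℝ) * M.ncard ≤ Nat.card V := by
          exact_mod_cast (hLmax Y T M hM hMr).trans (Set.ncard_le_card Y)
        have hT0 : (0 : ℝ) < T := by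
          by_contra! hT0
          have h2 := hF s
          have : (T : ℝ) * (τ (N s + n) * δ) ≤ 0 :=
            mul_nonpos_of_nonpos_of_nonneg hT0 (mul_pos (hτ0 _) hδ0).le
          linarith
        refine lt_of_mul_lt_mul_left ?_ hT0.le
        calc (T : ℝ) * M.ncard ≤ 1 * Nat.card V := by linarith
          _ < (T * τ (N s + n) * δ) * Nat.card V := by gcongr; exact hF s
          _ = (T * τ (N s + n)) * (δ * Nat.card V) := by ring
          _ ≤ (T * τ (N s + n)) * (core Y).ncard := by
            have := hτ0 (N s + n)
            gcongr
          _ = _ := by ring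
    · intro X hX
      rcases Finset.mem_union.1 hX with hX | hX
      · refine (hBZ X hX).trans (Set.sUnion_subset fun W hW => ?_)
        obtain ⟨Y, hY, t, -, rfl⟩ := (hZmem W).1 hW
        exact (hLsub Y t).trans (Set.subset_sUnion_of_mem hY)
      · obtain ⟨Y, hY, -, rfl⟩ := (hCmem X).1 hX
        exact Set.sdiff_subset.trans (Set.subset_sUnion_of_mem hY)
    -- Three losses of at most `ε / 3` each: from the induction, from the discarded block, and from
    -- small cores.
    · have hcover : ⋃₀ (A : Set (Set V)) \ ⋃₀ ((B ∪ C : Finset (Set V)) : Set (Set V)) ⊆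
          (⋃₀ (Z : Set (Set V)) \ ⋃₀ (B : Set (Set V))) ∪
            (⋃ Y ∈ A, ⋃ t ∈ Set.Ico s T, L Y t) ∪ ⋃ Y ∈ A \ A', core Y := by
        rintro a ⟨⟨Y, hY, haY⟩, ha⟩
        rw [Finset.coe_union, Set.sUnion_union, Set.mem_union, not_or] at ha
        by_cases hac : a ∈ core Y
        · refine Or.inr (Set.mem_biUnion (Finset.mem_sdiff.2 ⟨hY, fun hY' => ?_⟩) hac)
          exact ha.2 ⟨core Y, Finset.mem_image_of_mem _ hY', hac⟩
        · have : a ∈ ⋃ t < T, L Y t := by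
            by_contra h
            exact hac ⟨haY, h⟩
          simp only [Set.mem_iUnion] at this
          obtain ⟨t, ht, hat⟩ := this
          left
          rcases lt_or_ge t s with hts | hts
          · exact Or.inl ⟨⟨L Y t, (hZmem _).2 ⟨Y, hY, t, hts, rfl⟩, hat⟩, ha.1⟩
          · exact Or.inr (Set.mem_biUnion (show Y ∈ {Y | Y ∈ A} from hY)
              (Set.mem_biUnion (show t ∈ Set.Ico s T from ⟨hts, ht⟩) hat))
      have hsmall : ((⋃ Y ∈ A \ A', core Y).ncard : ℝ) ≤ n * (δ * Nat.card V) := by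
        calc ((⋃ Y ∈ A \ A', core Y).ncard : ℝ) ≤ ∑ Y ∈ A \ A', ((core Y).ncard : ℝ) := by
              exact_mod_cast Finset.set_ncard_biUnion_le _ _
          _ ≤ ∑ _Y ∈ A \ A', δ * (Nat.card V : ℝ) := Finset.sum_le_sum fun Y hY => by
              rw [Finset.mem_sdiff, Finset.mem_filter, not_and, not_le] at hY
              exact (hY.2 hY.1).le
          _ = (A \ A').card * (δ * Nat.card V) := by simp
          _ ≤ n * (δ * Nat.card V) := by
              have : (A \ A').card ≤ n := (Finset.card_le_card Finset.sdiff_subset).trans hAn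
              gcongr
      have h1 := (Set.ncard_le_ncard hcover).trans ((Set.ncard_union_le _ _).trans
        (Nat.add_le_add_right (Set.ncard_union_le _ _) _))
      have h2 : ((⋃₀ (A : Set (Set V)) \ ⋃₀ ((B ∪ C : Finset (Set V)) : Set (Set V))).ncard : ℝ) ≤
          (⋃₀ (Z : Set (Set V)) \ ⋃₀ (B : Set (Set V))).ncard +
            (⋃ Y ∈ A, ⋃ t ∈ Set.Ico s T, L Y t).ncard + (⋃ Y ∈ A \ A', core Y).ncard := by
        exact_mod_cast h1
      have h3 := mul_le_mul_of_nonneg_right hnδ hV.le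
      linarith

theorem lemma3p7 (k : ℕ) (hk : 1 ≤ k) (ε : ℝ) (hε : 0 < ε)
    (σ : ℕ → ℝ) (hσ : ∀ n : ℕ, σ n ∈ Set.Ioo (0 : ℝ) 1) :
    ∃ N : ℕ, ∀ (V : Type*) [Finite V] [Nonempty V] (G : SimpleGraph V), IsKStable G k →
      ∃ m : ℕ, 1 ≤ m ∧ m ≤ N ∧ ∃ X : Fin (m + 1) → Set V,
        IsPartitionOf X ∧
        ((X 0).ncard : ℝ) < ε * (Nat.card V : ℝ) ∧
        ∀ i : Fin (m + 1), i ≠ 0 → IsGood G (σ m) (X i) := by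
  -- Halving makes the bound strict, and the cap at `1` forces the family to be nonempty.
  obtain ⟨N, hN⟩ := exists_good_subfamily (2 * (2 ^ k - 1)) (min ε 1 / 2) (by positivity) σ
    (fun n => (hσ n).1) 1
  refine ⟨N, fun V _ _ G hG => ?_⟩
  have hV : (0 : ℝ) < Nat.card V := by exact_mod_cast Nat.card_pos
  obtain ⟨B, hBN, hBd, hBg, -, hBc⟩ := hN V G {Set.univ} (by simp) (by simp)
    (fun Y _ => hG.not_hasSplitTree _ _)
  rw [Finset.coe_singleton, Set.sUnion_singleton] at hBc
  refine ⟨B.card, ?_, hBN, Fin.cons (Set.univ \ ⋃₀ (B : Set (Set V)))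
    (fun i => (B.equivFin.symm i : Set V)), ⟨?_, ?_⟩, ?_, ?_⟩
  · rw [Nat.one_le_iff_ne_zero, Ne, Finset.card_eq_zero]
    rintro rfl
    simp only [Finset.coe_empty, Set.sUnion_empty, Set.sdiff_empty, Set.ncard_univ] at hBc
    nlinarith [min_le_right ε 1]
  · have h0 : ∀ i, Disjoint (Set.univ \ ⋃₀ (B : Set (Set V))) (B.equivFin.symm i : Set V) :=
      fun i => Set.disjoint_sdiff_left.mono_right
        (Set.subset_sUnion_of_mem (B.equivFin.symm i).2)
    refine Fin.cases (Fin.cases (fun h => (h rfl).elim) fun j _ => ?_) fun i =>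
      Fin.cases (fun _ => ?_) fun j hij => ?_
    · simpa using h0 j
    · simpa using (h0 i).symm
    · simp only [Fin.cons_succ]
      refine hBd (B.equivFin.symm i).2 (B.equivFin.symm j).2 fun h => hij ?_
      rw [B.equivFin.symm.injective (Subtype.ext h)]
  · refine Set.eq_univ_of_forall fun a => Set.mem_iUnion.2 ?_
    by_cases ha : a ∈ ⋃₀ (B : Set (Set V))
    · obtain ⟨X, hX, haX⟩ := ha
      exact ⟨(B.equivFin ⟨X, hX⟩).succ, by simpa using haX⟩
    · exact ⟨0, trivial, ha⟩
  · have : min ε 1 / 2 < ε := by linarith [min_le_left ε 1]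
    exact lt_of_le_of_lt hBc (by gcongr)
  · refine Fin.cases (fun h => (h rfl).elim) fun i _ => ?_
    exact hBg _ (B.equivFin.symm i).2
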